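/- Let $f:\mathbb{R}^2\setminus\{y=0\}\to\mathbb{R}^2\setminus\{y=-x\}$, $f(x,y)=\left(x+\frac1y,\;y-\frac1y-x\right)$, be the Hénon–Devaney map, a bijection with inverse $f^{-1}(x,y)=\left(x-\frac1{x+y},\;x+y\right)$. For $n\ge 0$ let $f^{-n}(\{y=0\})$ be the set of points at which $f^n$ is defined and has its value on the line $\{y=0\}$, and let $f^{n}(\{y=-x\})$ be the set of values of $f^n$ at those points of the line $\{y=-x\}$ at which $f^n$ is defined. Let $\mathcal R$ be the set of all connected components of the sets $f^{-n}(\{y=0\})$, $n\ge0$, and $\mathcal L$ the set of all connected components of the sets $f^{n}(\{y=-x\})$, $n\ge 0$. A family of subsets of the plane is called a lamination of the plane by smooth curves if (i) each member is the image of a $C^\infty$ map $\gamma:\mathbb{R}\to\mathbb{R}^2$ with nowhere vanishing derivative that is a closed embedding; (ii) distinct members are disjoint; (iii) every point of the plane lies in an open set $U$ with a homeomorphism $\varphi:U\to(-1,1)^2$ such that for each member $C$ there is a set $T\subseteq(-1,1)$ with $\varphi(C\cap U)=(-1,1)\times T$. Then $\mathcal R$ and $\mathcal L$ are laminations of the plane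 by smooth curves, and each curve of $\mathcal R$ is transverse to each curve of $\mathcal L$: at every common point their tangent lines together span $\mathbb{R}^2$. Moreover: (a) The sets $f^{-n}(\{y=0\})$, $n\ge 0$, are pairwise disjoint, and so are the sets $f^{n}(\{y=-x\})$, $n\ge 0$. (b) On each connected set of parameters $t$ at which $f^{-n}(t,0)$ is defined, both coordinates of $f^{-n}(t,0)$ are strictly increasing in $t$, for $n\ge1$. On each connected set of parameters $t$ at which $f^{n}(t,-t)$ is defined, the first coordinate of $f^n(t,-t)$ is strictly increasing and the second strictly decreasing in $t$, for $n\ge0$. (c) Write $f^{-j}(t,0)=(x_j(t),y_j(t))$. For each $n\ge 0$ there is exactly one $t_n\in\mathbb{R}$ with $x_j(t_n)+y_j(t_n)>0$ for all $0\le j<n$ (so that $f^{-n}(t_n,0)$ is defined) and $x_n(t_n)=0$; and $y_n(t_n)\to\infty$ as $n\to\infty$. -/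

import Mathlib

open Set Filter Topology
open scoped ContDiff

noncomputable section

namespace HenonDevaney

/-- The formula `(x, y) ↦ (x + 1/y, y - 1/y - x)` of the Hénon-Devaney map. The map itself is
defined only where `y ≠ 0`; every use below carries that condition. -/
def hd (p : ℝ × ℝ) : ℝ × ℝ := (p.1 + 1 / p.2, p.2 - 1 / p.2 - p.1)

/-- The formula `(x, y) ↦ (x - 1/(x+y), x + y)` of the inverse map, which is defined only where
`x + y ≠ 0`. -/
def hdInv (p : ℝ × ℝ) : ℝ × ℝ := (p.1 - 1 / (p.1 + p.2), p.1 + p.2)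

/-- `hd` maps `{y ≠ 0}` into `{x + y ≠ 0}`, and `hdInv` undoes it. -/
theorem hdInv_hd (p : ℝ × ℝ) (hp : p.2 ≠ 0) :
    (hd p).1 + (hd p).2 ≠ 0 ∧ hdInv (hd p) = p := by
  have h : (hd p).1 + (hd p).2 = p.2 := by simp only [hd]; ring
  refine ⟨by rw [h]; exact hp, ?_⟩
  unfold hdInv
  rw [h]
  ext <;> simp [hd]

/-- `hdInv` maps `{x + y ≠ 0}` into `{y ≠ 0}`, and `hd` undoes it. -/
theorem hd_hdInv (p : ℝ × ℝ) (hp : p.1 + p.2 ≠ 0) :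
    (hdInv p).2 ≠ 0 ∧ hd (hdInv p) = p := by
  refine ⟨hp, ?_⟩
  ext <;> simp [hd, hdInv]

/-- The set `f⁻ⁿ({y = 0})`: the points at which `fⁿ` is defined and takes a value in
`{y = 0}`. -/
def preAxis : ℕ → Set (ℝ × ℝ)
  | 0 => {p | p.2 = 0}
  | n + 1 => {p | p.2 ≠ 0 ∧ hd p ∈ preAxis n}

/-- The set `fⁿ({y = -x})`: the values of `fⁿ` at the points of `{y = -x}` at which it is
defined. -/
def imgAnti : ℕ → Set (ℝ × ℝ)
  | 0 => {p | p.2 = -p.1}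
  | n + 1 => hd '' {p | p ∈ imgAnti n ∧ p.2 ≠ 0}

/-- The curves that make up the sets `S n`: all connected components of all of these sets. -/
def curvesOf (S : ℕ → Set (ℝ × ℝ)) : Set (Set (ℝ × ℝ)) :=
  {C | ∃ n, ∃ p ∈ S n, C = connectedComponentIn (S n) p}

/-- A smooth, properly embedded curve in the plane: the image of a regular smooth map `ℝ → ℝ²`
that is a closed embedding. -/
def IsSmoothLine (C : Set (ℝ × ℝ)) : Prop :=
  ∃ γ : ℝ → ℝ × ℝ, ContDiff ℝ ∞ γ ∧ (∀ t, deriv γ t ≠ 0) ∧ IsClosedEmbedding γ ∧ range γ = C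

/-- A family of curves is a lamination of the plane by smooth lines: the curves (leaves) are
smooth and properly embedded, distinct ones are disjoint, and around every point of the plane
there is a flow box, that is, a chart onto a square which takes the part of each leaf in its
domain onto a union of full horizontal segments (plaques). -/
structure IsLamination (F : Set (Set (ℝ × ℝ))) : Prop where
  smooth : ∀ C ∈ F, IsSmoothLine C
  disjoint : F.PairwiseDisjoint id
  flowBox : ∀ p : ℝ × ℝ, ∃ φ : OpenPartialHomeomorph (ℝ × ℝ) (ℝ × ℝ),
    p ∈ φ.source ∧ φ.target = Ioo (-1 : ℝ) 1 ×ˢ Ioo (-1 : ℝ) 1 ∧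
      ∀ C ∈ F, ∃ T : Set ℝ, φ '' (C ∩ φ.source) = Ioo (-1 : ℝ) 1 ×ˢ T

/-- The tangent vectors of a curve `C` at `p`: the velocities at `p` of paths that run in `C`. -/
def tangentVectors (C : Set (ℝ × ℝ)) (p : ℝ × ℝ) : Set (ℝ × ℝ) :=
  {v | ∃ γ : ℝ → ℝ × ℝ, (∀ t, γ t ∈ C) ∧ γ 0 = p ∧ HasDerivAt γ v 0}

/-- Two curves are transverse: at each common point their tangent spaces together span the
plane. -/
def Transverse (C D : Set (ℝ × ℝ)) : Prop :=
  ∀ p ∈ C ∩ D, Submodule.span ℝ (tangentVectors C p ∪ tangentVectors D p) = ⊤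

/-- The parameters `t` at which `f⁻ⁿ(t, 0)` is defined. -/
def preDomain (n : ℕ) : Set ℝ :=
  {t | ∀ j < n, (hdInv^[j] (t, 0)).1 + (hdInv^[j] (t, 0)).2 ≠ 0}

/-- The parameters `t` at which `fⁿ(t, -t)` is defined. -/
def imgDomain (n : ℕ) : Set ℝ :=
  {t | ∀ j < n, (hd^[j] (t, -t)).2 ≠ 0}

end HenonDevaney

end

namespace HenonDevaney

/-! The preimage under `hd` of the graph of a smooth nondecreasing function is a pair of such
graphs, one on each side of the axis. So the curves of `preAxis` are smooth nondecreasing graphs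
over the whole line, and they are pairwise disjoint because an orbit ends when it meets the axis.

The flow boxes rest on density: every vertical segment meets some curve
(`exists_mem_preAxis_of_lt`). Otherwise all iterates would be continuous on the segment and the
orbits of its ends would always lie on the same side of the axis, which `not_forall_same_side`
forbids. Disjoint graphs that are dense on verticals are straightened by one homeomorphism of the
plane (`IsDenseFamily.exists_chart`).

The involution `flip` conjugates `hd` to `hdInv` and exchanges the two families. It turns slopes `≥
0` into slopes `≤ -1`, whence transversality. Density also forces the highest curve of order `n` to
rise to infinity. -/

/-! ### Orbits and the sides of the axis -/

theorem not_forall_pos_of_orbit {x y : ℕ → ℝ} (hx : ∀ n, x (n + 1) = x n + 1 / y n)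
    (hy : ∀ n, y (n + 1) = y n - x (n + 1)) : ¬ ∀ n, 0 < y n := by
  intro hpos
  have hmono : Monotone x := monotone_nat_of_le_succ fun n => by
    have := hpos n
    rw [hx]
    have : 0 < 1 / y n := by positivity
    linarith
  -- Once `x` is positive, `y` loses at least a fixed amount per step. If `x` never is, `y` grows at
  -- most linearly, and the increments `1 / y` of `x` dominate a divergent harmonic series.
  by_cases hm : ∃ m, 0 < x m
  · obtain ⟨m, hm⟩ := hm
    have key : ∀ k : ℕ, y (m + k) ≤ y m - k * x m := by
      intro k
      induction k with
      | zero => simp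
      | succ k ih =>
        have h1 := hy (m + k)
        have h2 : x m ≤ x (m + k + 1) := hmono (by omega)
        rw [← add_assoc, h1]
        push_cast
        linarith
    obtain ⟨k, hk⟩ := exists_nat_gt (y m / x m)
    rw [div_lt_iff₀ hm] at hk
    linarith [key k, hpos (m + k)]
  · push Not at hm
    have hA : 0 < y 0 - x 0 := by linarith [hpos 0, hm 0]
    have hbound : ∀ n : ℕ, y n ≤ (y 0 - x 0) * (n + 1) := by
      have : ∀ n : ℕ, y n ≤ y 0 - x 0 * n := by
        intro n
        induction n with
        | zero => simp
        | succ n ih =>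
          have h2 : x 0 ≤ x (n + 1) := hmono (by omega)
          rw [hy]
          push_cast
          linarith
      intro n
      have hn : (0 : ℝ) ≤ n := n.cast_nonneg
      nlinarith [this n, hpos 0, hm 0]
    have hsum : ∀ n : ℕ, x 0 + (∑ i ∈ Finset.range n, 1 / ((i : ℝ) + 1)) / (y 0 - x 0) ≤ x n := by
      intro n
      induction n with
      | zero => simp
      | succ n ih =>
        rw [Finset.sum_range_succ, add_div, hx, div_div, mul_comm ((n : ℝ) + 1)]
        have := one_div_le_one_div_of_le (hpos n) (hbound n)
        linarith
    obtain ⟨n, hn⟩ := ((tendsto_atTop.1 Real.tendsto_sum_range_one_div_nat_succ_atTop)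
      ((1 - x 0) * (y 0 - x 0))).exists
    have h1 := hsum n
    rw [← le_div_iff₀ hA] at hn
    linarith [hm n]

/-- The recursion is invariant under negation of both sequences, so an orbit can remain on neither
side of the axis. -/
theorem exists_sign_change_of_orbit {x y : ℕ → ℝ} (hx : ∀ n, x (n + 1) = x n + 1 / y n)
    (hy : ∀ n, y (n + 1) = y n - x (n + 1)) (hne : ∀ n, y n ≠ 0) (N : ℕ) :
    ∃ n, N ≤ n ∧ 0 < y n ∧ y (n + 1) < 0 := by
  obtain ⟨m, hm⟩ : ∃ m, 0 < y (N + m) := by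
    by_contra! h
    refine not_forall_pos_of_orbit (x := fun n => - x (N + n)) (y := fun n => - y (N + n))
      (fun n => ?_) (fun n => ?_) (fun n => ?_)
    · simp only [← add_assoc, hx, one_div, inv_neg]
      ring
    · simp only [← add_assoc, hy]
      ring
    · have := lt_of_le_of_ne (h n) (hne _)
      simpa using this
  by_contra! h
  refine not_forall_pos_of_orbit (x := fun n => x (N + m + n)) (y := fun n => y (N + m + n))
    (fun n => hx _) (fun n => hy _) (fun n => ?_)
  induction n with
  | zero => exact hm
  | succ n ih => exact lt_of_le_of_ne (h (N + m + n) (by omega) ih) (hne _).symm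

/-- Following an orbit back from a point with large first coordinate, the first coordinate
decays slowly. -/
theorem le_fst_of_orbit {x y : ℕ → ℝ} (hx : ∀ n, x (n + 1) = x n + 1 / y n)
    (hy : ∀ n, y (n + 1) = y n - x (n + 1)) {n : ℕ} (hyn : 1 ≤ y n) (hX : 0 < x (n + 1))
    (hn : 2 * n / x (n + 1) ≤ x (n + 1) / 2 - 1) : x (n + 1) / 2 ≤ x 0 := by
  set X := x (n + 1) with hXdef
  -- The first step back costs at most `1`. The assumption `hn` keeps `x` above `X / 2`, hence also
  -- the preceding `y`, so each further step costs at most `2 / X`.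
  have key : ∀ k ≤ n, X - 1 - 2 * k / X ≤ x (n - k) ∧ 0 < y (n - k) := by
    intro k
    induction k with
    | zero =>
      intro _
      refine ⟨?_, by simpa using by linarith⟩
      have h1 := hx n
      have h2 : 1 / y n ≤ 1 := by rw [div_le_one (by linarith)]; exact hyn
      simp only [CharP.cast_eq_zero, mul_zero, zero_div, sub_zero, Nat.sub_zero]
      linarith
    | succ k ih =>
      intro hk
      obtain ⟨h1, h2⟩ := ih (by omega)
      obtain ⟨j, hj⟩ : ∃ j, n = j + (k + 1) := ⟨n - (k + 1), by omega⟩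
      have e1 : n - k = j + 1 := by omega
      have e2 : n - (k + 1) = j := by omega
      rw [e1] at h1 h2
      rw [e2]
      have hkn : 2 * (k : ℝ) / X ≤ 2 * n / X := by
        gcongr
        omega
      have h3 : X / 2 ≤ y j := by linarith [hy j]
      refine ⟨?_, by linarith⟩
      have h4 : 1 / y j ≤ 1 / (X / 2) := one_div_le_one_div_of_le (by linarith) h3
      have h5 : 2 * ((k + 1 : ℕ) : ℝ) / X = 2 * k / X + 1 / (X / 2) := by
        push_cast
        field_simp
      rw [h5]
      linarith [hx j]
  have := (key n le_rfl).1
  simp only [Nat.sub_self] at this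
  linarith

/-- Two orbits that start at different points of a vertical line cannot stay on the same side
of the `x`-axis forever. -/
theorem not_forall_same_side {x y x' y' : ℕ → ℝ}
    (hx : ∀ n, x (n + 1) = x n + 1 / y n) (hy : ∀ n, y (n + 1) = y n - x (n + 1))
    (hx' : ∀ n, x' (n + 1) = x' n + 1 / y' n) (hy' : ∀ n, y' (n + 1) = y' n - x' (n + 1))
    (h0 : x 0 = x' 0) (hlt : y' 0 < y 0) : ¬ ∀ n, 0 < y n * y' n := by
  intro hs
  have hne : ∀ n, y n ≠ 0 := fun n h => by simpa [h] using hs n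
  have hne' : ∀ n, y' n ≠ 0 := fun n h => by simpa [h] using hs n
  have stepx : ∀ n, x' (n + 1) - x (n + 1) = x' n - x n + (y n - y' n) / (y n * y' n) := by
    intro n
    have := hne n
    have := hne' n
    rw [hx, hx']
    field_simp
    ring
  have stepy : ∀ n, y (n + 1) - y' (n + 1) = y n - y' n + (x' (n + 1) - x (n + 1)) := by
    intro n
    rw [hy, hy']
    ring
  -- Equal signs make `1 / y' - 1 / y` positive when `y' < y`, so neither gap ever shrinks.
  have pos : ∀ n, 0 ≤ x' n - x n ∧ 0 < y n - y' n := by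
    intro n
    induction n with
    | zero => exact ⟨by linarith, by linarith⟩
    | succ n ih =>
      have h1 : 0 < (y n - y' n) / (y n * y' n) := div_pos ih.2 (hs n)
      have h2 := stepx n
      have h3 := stepy n
      exact ⟨by linarith, by linarith⟩
  have hα : 0 < x' 1 - x 1 := by
    have h1 : 0 < (y 0 - y' 0) / (y 0 * y' 0) := div_pos (pos 0).2 (hs 0)
    have := stepx 0
    rw [h0] at this
    simp only [zero_add] at this
    linarith
  set α := x' 1 - x 1 with hαdef
  have hge : ∀ n, α ≤ x' (n + 1) - x (n + 1) := by
    intro n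
    induction n with
    | zero => exact le_rfl
    | succ n ih =>
      have h1 := div_pos (pos (n + 1)).2 (hs (n + 1))
      linarith [stepx (n + 1)]
  have hb : ∀ n : ℕ, n * α < y n - y' n := by
    intro n
    induction n with
    | zero => simpa using (pos 0).2
    | succ n ih =>
      push_cast
      linarith [stepy n, hge n]
  -- At a late sign change, `x (n + 1) > y n > n * α` and `x (n + 1) > B`. The term `4 / α + 10`
  -- meets the smallness condition of `le_fst_of_orbit`; the term `2 * |x 0|` makes its conclusion
  -- absurd.
  set B : ℝ := 4 / α + 10 + 2 * |x 0| with hB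
  obtain ⟨N, hN⟩ := exists_nat_gt (B / α)
  rw [div_lt_iff₀ hα] at hN
  obtain ⟨n, hn, hyn, hyn1⟩ := exists_sign_change_of_orbit hx hy hne N
  have hy'n : 0 < y' n := (pos_iff_pos_of_mul_pos (hs n)).1 hyn
  have hNn : (N : ℝ) * α ≤ n * α := by gcongr
  have h4 : 0 < 4 / α := by positivity
  have habs := abs_nonneg (x 0)
  have hX : y n < x (n + 1) := by linarith [hy n]
  have hBX : B < x (n + 1) := by linarith [hb n]
  have h5 : 2 * (n : ℝ) / x (n + 1) ≤ 2 / α := by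
    rw [div_le_div_iff₀ (by linarith) hα]
    linarith [hb n]
  have h6 : 4 / α = 2 * (2 / α) := by ring
  have := le_fst_of_orbit hx hy (n := n) (by linarith [hb n]) (by linarith) (by linarith)
  linarith [le_abs_self (x 0)]

/-! ### Preimages of monotone graphs -/

/-- The graph of a real function. -/
def graph (g : ℝ → ℝ) : Set (ℝ × ℝ) := {p | p.2 = g p.1}

theorem mem_graph {g : ℝ → ℝ} {p : ℝ × ℝ} : p ∈ graph g ↔ p.2 = g p.1 := Iff.rfl

/-- The function whose graph is the part in `{y > 0}` of the preimage under `hd` of the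
graph of `g`. -/
noncomputable def upperBranch (g : ℝ → ℝ) (x : ℝ) : ℝ :=
  Classical.epsilon fun y => 0 < y ∧ y - 1 / y - x = g (x + 1 / y)

/-- The function whose graph is the part in `{y < 0}` of the preimage under `hd` of the
graph of `g`. -/
noncomputable def lowerBranch (g : ℝ → ℝ) (x : ℝ) : ℝ :=
  - upperBranch (fun t => - g (-t)) (-x)

theorem exists_upperBranch {g : ℝ → ℝ} (hc : Continuous g) (hm : Monotone g) (x : ℝ) :
    ∃ y, 0 < y ∧ y - 1 / y - x = g (x + 1 / y) := by
  set F : ℝ → ℝ := fun y => y - 1 / y - x - g (x + 1 / y) with hF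
  -- Monotonicity compares the values of `g` needed at `y = 1 / M` and `y = M` with `g (x + 1)`, so
  -- this `M` gives `F` opposite signs there.
  set M : ℝ := 2 + |x| + |g (x + 1)| with hM
  have h1 := abs_nonneg x
  have h2 := abs_nonneg (g (x + 1))
  have hMpos : 0 < M := by linarith
  have hinv : 1 / M ≤ 1 := by rw [div_le_one hMpos]; linarith
  have hcont : ContinuousOn F (Icc (1 / M) M) := by
    have hne : ∀ y ∈ Icc (1 / M) M, y ≠ 0 := fun y hy =>
      (lt_of_lt_of_le (by positivity) hy.1).ne'
    have hd : ContinuousOn (fun y : ℝ => 1 / y) (Icc (1 / M) M) :=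
      continuousOn_const.div continuousOn_id hne
    exact ((continuousOn_id.sub hd).sub continuousOn_const).sub
      (hc.comp_continuousOn (continuousOn_const.add hd))
  have hlo : F (1 / M) ≤ 0 := by
    have h3 : g (x + 1) ≤ g (x + M) := hm (by linarith)
    simp only [hF, one_div_one_div]
    linarith [neg_abs_le x, neg_abs_le (g (x + 1))]
  have hhi : 0 ≤ F M := by
    have h3 : g (x + 1 / M) ≤ g (x + 1) := hm (by linarith)
    simp only [hF]
    linarith [le_abs_self x, le_abs_self (g (x + 1))]
  obtain ⟨y, hy, hy0⟩ := intermediate_value_Icc (by linarith : 1 / M ≤ M) hcont ⟨hlo, hhi⟩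
  exact ⟨y, lt_of_lt_of_le (by positivity) hy.1, by simp only [hF] at hy0; linarith⟩

theorem upperBranch_spec {g : ℝ → ℝ} (hc : Continuous g) (hm : Monotone g) (x : ℝ) :
    0 < upperBranch g x ∧
      upperBranch g x - 1 / upperBranch g x - x = g (x + 1 / upperBranch g x) :=
  Classical.epsilon_spec (exists_upperBranch hc hm x)

/-- A comparison principle for the equation that defines `upperBranch`. -/
theorem le_of_branch_eq {g h : ℝ → ℝ} (hm : Monotone g) (hgh : ∀ x, g x ≤ h x) {x x' y y' : ℝ}
    (hxx : x ≤ x') (hy' : 0 < y') (e : y - 1 / y - x = g (x + 1 / y))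
    (e' : y' - 1 / y' - x' = h (x' + 1 / y')) : y ≤ y' := by
  -- As `y > 0` grows, `y - 1 / y` increases while `g (x + 1 / y)` does not.
  by_contra! hlt
  have h1 : 1 / y < 1 / y' := one_div_lt_one_div_of_lt hy' hlt
  have h2 : g (x + 1 / y) ≤ g (x' + 1 / y') := hm (by linarith)
  linarith [hgh (x' + 1 / y')]

theorem eq_upperBranch {g : ℝ → ℝ} (hc : Continuous g) (hm : Monotone g) {x y : ℝ} (hy : 0 < y)
    (e : y - 1 / y - x = g (x + 1 / y)) : y = upperBranch g x := by
  obtain ⟨h1, h2⟩ := upperBranch_spec hc hm x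
  exact le_antisymm (le_of_branch_eq hm (fun _ => le_rfl) le_rfl h1 e h2)
    (le_of_branch_eq hm (fun _ => le_rfl) le_rfl hy h2 e)

theorem upperBranch_mono {g h : ℝ → ℝ} (hc : Continuous g) (hm : Monotone g)
    (hc' : Continuous h) (hm' : Monotone h) (hgh : ∀ x, g x ≤ h x) (x : ℝ) :
    upperBranch g x ≤ upperBranch h x := by
  obtain ⟨-, h2⟩ := upperBranch_spec hc hm x
  obtain ⟨h3, h4⟩ := upperBranch_spec hc' hm' x
  exact le_of_branch_eq hm hgh le_rfl h3 h2 h4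

theorem monotone_upperBranch {g : ℝ → ℝ} (hc : Continuous g) (hm : Monotone g) :
    Monotone (upperBranch g) := fun x x' hxx => by
  obtain ⟨-, h2⟩ := upperBranch_spec hc hm x
  obtain ⟨h3, h4⟩ := upperBranch_spec hc hm x'
  exact le_of_branch_eq hm (fun _ => le_rfl) hxx h3 h2 h4

theorem mem_graph_upperBranch {g : ℝ → ℝ} (hc : Continuous g) (hm : Monotone g) {p : ℝ × ℝ} :
    p ∈ graph (upperBranch g) ↔ 0 < p.2 ∧ hd p ∈ graph g := by
  simp only [mem_graph, hd]
  constructor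
  · intro h
    have := upperBranch_spec hc hm p.1
    rwa [← h] at this
  · rintro ⟨h1, h2⟩
    exact eq_upperBranch hc hm h1 h2

theorem isInvertible_of_apply_one_ne_zero {L : ℝ →L[ℝ] ℝ} (h : L 1 ≠ 0) : L.IsInvertible := by
  refine ⟨ContinuousLinearEquiv.unitsEquivAut ℝ (Units.mk0 _ h), ?_⟩
  ext
  simp

/-- Implicit function theorem: the `y`-derivative of `F` is `1 + (1 + g') / y ^ 2 > 0`, as `g' ≥ 0`.
Uniqueness of the positive solution identifies the implicit function with `upperBranch g`. -/
theorem contDiff_upperBranch {g : ℝ → ℝ} (hg : ContDiff ℝ ∞ g) (hm : Monotone g) :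
    ContDiff ℝ ∞ (upperBranch g) := by
  rw [contDiff_iff_contDiffAt]
  intro x₀
  obtain ⟨hpos, heq⟩ := upperBranch_spec hg.continuous hm x₀
  set y₀ := upperBranch g x₀ with hy₀
  set F : ℝ × ℝ → ℝ := fun p => p.2 - 1 / p.2 - p.1 - g (p.1 + 1 / p.2) with hF
  have hFs : ContDiffAt ℝ ∞ F (x₀, y₀) := by
    have hinv : ContDiffAt ℝ ∞ (fun p : ℝ × ℝ => 1 / p.2) (x₀, y₀) :=
      contDiffAt_const.div contDiffAt_snd hpos.ne'
    exact ((contDiffAt_snd.sub hinv).sub contDiffAt_fst).sub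
      (hg.contDiffAt.comp _ (contDiffAt_fst.add hinv))
  have h0 : (∞ : ℕ∞ω) ≠ 0 := by simp
  have hinv : (fderiv ℝ F (x₀, y₀) ∘L .inr ℝ ℝ ℝ).IsInvertible := by
    apply isInvertible_of_apply_one_ne_zero
    have hd1 : HasDerivAt (fun y : ℝ => 1 / y) (-(y₀ ^ 2)⁻¹) y₀ := by
      simpa using hasDerivAt_inv hpos.ne'
    have hd2 : HasDerivAt (fun y : ℝ => g (x₀ + 1 / y))
        (deriv g (x₀ + 1 / y₀) * (-(y₀ ^ 2)⁻¹)) y₀ :=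
      ((hg.differentiable h0 _).hasDerivAt).comp y₀ (hd1.const_add x₀)
    have hd3 : HasDerivAt (fun y : ℝ => F (x₀, y))
        (1 - -(y₀ ^ 2)⁻¹ - deriv g (x₀ + 1 / y₀) * (-(y₀ ^ 2)⁻¹)) y₀ :=
      (((hasDerivAt_id y₀).sub hd1).sub_const x₀).sub hd2
    have hd4 : HasDerivAt (fun y : ℝ => F (x₀, y)) (fderiv ℝ F (x₀, y₀) (0, 1)) y₀ :=
      (hFs.differentiableAt h0).hasFDerivAt.comp_hasDerivAt y₀
        ((hasDerivAt_const y₀ x₀).prodMk (hasDerivAt_id y₀))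
    have h5 : 0 ≤ deriv g (x₀ + 1 / y₀) := hm.deriv_nonneg
    have h6 : 0 < (y₀ ^ 2)⁻¹ := by positivity
    have h7 : fderiv ℝ F (x₀, y₀) (0, 1) ≠ 0 := by
      rw [hd4.unique hd3]
      nlinarith [mul_nonneg h5 h6.le]
    simpa using h7
  have hψ := hFs.contDiffAt_implicitFunction h0 hinv
  refine hψ.congr_of_eventuallyEq ?_
  have hF0 : F (x₀, y₀) = 0 := by simp only [hF]; linarith
  have hself := hFs.implicitFunction_apply_self h0 hinv
  have hposev : ∀ᶠ x in 𝓝 x₀, 0 < hFs.implicitFunction h0 hinv x :=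
    hψ.continuousAt.eventually (lt_mem_nhds (by rw [hself]; exact hpos))
  filter_upwards [hFs.eventually_apply_implicitFunction h0 hinv, hposev] with x hx1 hx2
  rw [hF0] at hx1
  exact (eq_upperBranch hg.continuous hm hx2 (by simp only [hF] at hx1; linarith)).symm

theorem contDiff_reflect {g : ℝ → ℝ} (hg : ContDiff ℝ ∞ g) :
    ContDiff ℝ ∞ (fun t => - g (-t)) := (hg.comp contDiff_neg).neg

theorem monotone_reflect {g : ℝ → ℝ} (hm : Monotone g) : Monotone (fun t => - g (-t)) :=
  fun _ _ h => neg_le_neg (hm (neg_le_neg h))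

theorem contDiff_lowerBranch {g : ℝ → ℝ} (hg : ContDiff ℝ ∞ g) (hm : Monotone g) :
    ContDiff ℝ ∞ (lowerBranch g) :=
  contDiff_reflect (contDiff_upperBranch (contDiff_reflect hg) (monotone_reflect hm))

theorem monotone_lowerBranch {g : ℝ → ℝ} (hg : Continuous g) (hm : Monotone g) :
    Monotone (lowerBranch g) :=
  monotone_reflect (monotone_upperBranch (by fun_prop) (monotone_reflect hm))

theorem mem_graph_lowerBranch {g : ℝ → ℝ} (hc : Continuous g) (hm : Monotone g) {p : ℝ × ℝ} :
    p ∈ graph (lowerBranch g) ↔ p.2 < 0 ∧ hd p ∈ graph g := by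
  have h := mem_graph_upperBranch (g := fun t => - g (-t)) (by fun_prop) (monotone_reflect hm)
    (p := -p)
  have e : p ∈ graph (lowerBranch g) ↔ -p ∈ graph (upperBranch fun t => - g (-t)) := by
    simp only [mem_graph, lowerBranch, Prod.fst_neg, Prod.snd_neg]
    constructor <;> intro h <;> linarith
  -- The map `hd` is odd, which reduces the lower branch to the upper one.
  have e1 : -(hd (-p)).1 = (hd p).1 := by
    simp only [hd, Prod.fst_neg, Prod.snd_neg, one_div, inv_neg]; ring
  have e2 : -(hd (-p)).2 = (hd p).2 := by
    simp only [hd, Prod.fst_neg, Prod.snd_neg, one_div, inv_neg]; ring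
  rw [e, h, mem_graph, mem_graph, e1, ← e2, Prod.snd_neg, neg_pos]
  refine and_congr_right fun _ => ?_
  constructor <;> intro h <;> linarith

/-! ### Straightening a dense family of graphs -/

/-- A family of continuous functions with pairwise disjoint graphs, which on each vertical line
are dense. -/
structure IsDenseFamily (G : Set (ℝ → ℝ)) : Prop where
  continuous : ∀ g ∈ G, Continuous g
  lt_of_lt : ∀ g ∈ G, ∀ h ∈ G, ∀ x x', g x < h x → g x' < h x'
  dense : ∀ x y y', y < y' → ∃ g ∈ G, y < g x ∧ g x < y'

/-- The height over `b` of the curve of the closure of `G` that passes at height `y` over `a`. -/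
noncomputable def transport (G : Set (ℝ → ℝ)) (a b y : ℝ) : ℝ :=
  sSup {z | ∃ g ∈ G, g a ≤ y ∧ g b = z}

namespace IsDenseFamily

variable {G : Set (ℝ → ℝ)}

theorem le_of_le (hG : IsDenseFamily G) {g h : ℝ → ℝ} (hg : g ∈ G) (hh : h ∈ G) {x : ℝ} (x' : ℝ)
    (H : g x ≤ h x) : g x' ≤ h x' := by
  by_contra! hlt
  exact absurd (hG.lt_of_lt h hh g hg x' x hlt) (not_lt.2 H)

theorem le_transport (hG : IsDenseFamily G) {g : ℝ → ℝ} (hg : g ∈ G) {a y : ℝ} (b : ℝ)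
    (h : g a ≤ y) : g b ≤ transport G a b y := by
  refine le_csSup ?_ ⟨g, hg, h, rfl⟩
  obtain ⟨k, hk, hk1, -⟩ := hG.dense a y (y + 1) (by linarith)
  refine ⟨k b, ?_⟩
  rintro _ ⟨l, hl, hl1, rfl⟩
  exact hG.le_of_le hl hk b (hl1.trans hk1.le)

theorem transport_le (hG : IsDenseFamily G) {g : ℝ → ℝ} (hg : g ∈ G) {a y : ℝ} (b : ℝ)
    (h : y ≤ g a) : transport G a b y ≤ g b := by
  obtain ⟨k, hk, -, hk1⟩ := hG.dense a (y - 1) y (by linarith)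
  refine csSup_le ⟨k b, k, hk, hk1.le, rfl⟩ ?_
  rintro _ ⟨l, hl, hl1, rfl⟩
  exact hG.le_of_le hl hg b (hl1.trans h)

theorem lt_transport (hG : IsDenseFamily G) {g : ℝ → ℝ} (hg : g ∈ G) {a y : ℝ} (b : ℝ)
    (h : g a < y) : g b < transport G a b y := by
  obtain ⟨k, hk, hk1, hk2⟩ := hG.dense a _ _ h
  exact (hG.lt_of_lt g hg k hk a b hk1).trans_le (hG.le_transport hk b hk2.le)

theorem transport_lt (hG : IsDenseFamily G) {g : ℝ → ℝ} (hg : g ∈ G) {a y : ℝ} (b : ℝ)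
    (h : y < g a) : transport G a b y < g b := by
  obtain ⟨k, hk, hk1, hk2⟩ := hG.dense a _ _ h
  exact (hG.transport_le hk b hk1.le).trans_lt (hG.lt_of_lt k hk g hg a b hk2)

theorem transport_apply (hG : IsDenseFamily G) {g : ℝ → ℝ} (hg : g ∈ G) (a b : ℝ) :
    transport G a b (g a) = g b :=
  le_antisymm (hG.transport_le hg b le_rfl) (hG.le_transport hg b le_rfl)

theorem transport_transport (hG : IsDenseFamily G) (a b y : ℝ) :
    transport G b a (transport G a b y) = y := by
  refine le_antisymm ?_ ?_ <;> by_contra! h <;> obtain ⟨g, hg, h1, h2⟩ := hG.dense a _ _ h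
  · exact absurd (hG.transport_lt hg a (hG.transport_lt hg b h1)) (not_lt.2 h2.le)
  · exact absurd (hG.lt_transport hg a (hG.lt_transport hg b h2)) (not_lt.2 h1.le)

/-- A member of `G` passing strictly between the transported height and a given bound is a barrier
that persists for nearby arguments. -/
theorem continuous_transport (hG : IsDenseFamily G) :
    Continuous fun q : ℝ × ℝ × ℝ => transport G q.1 q.2.1 q.2.2 := by
  rw [continuous_iff_continuousAt]
  rintro ⟨a, b, y⟩
  refine tendsto_order.2 ⟨fun l hl => ?_, fun u hu => ?_⟩
  · obtain ⟨g, hg, h1, h2⟩ := hG.dense b _ _ hl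
    have h3 : g a < y := by
      by_contra! h
      exact absurd (hG.transport_le hg b h) (not_le.2 h2)
    have hc := hG.continuous g hg
    have e1 : ∀ᶠ q : ℝ × ℝ × ℝ in 𝓝 (a, b, y), g q.1 < q.2.2 :=
      (isOpen_lt (by fun_prop) (by fun_prop)).mem_nhds h3
    have e2 : ∀ᶠ q : ℝ × ℝ × ℝ in 𝓝 (a, b, y), l < g q.2.1 :=
      (isOpen_lt (by fun_prop) (by fun_prop)).mem_nhds h1
    filter_upwards [e1, e2] with q hq1 hq2
    exact hq2.trans (hG.lt_transport hg _ hq1)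
  · obtain ⟨g, hg, h1, h2⟩ := hG.dense b _ _ hu
    have h3 : y < g a := by
      by_contra! h
      exact absurd (hG.le_transport hg b h) (not_le.2 h1)
    have hc := hG.continuous g hg
    have e1 : ∀ᶠ q : ℝ × ℝ × ℝ in 𝓝 (a, b, y), q.2.2 < g q.1 :=
      (isOpen_lt (by fun_prop) (by fun_prop)).mem_nhds h3
    have e2 : ∀ᶠ q : ℝ × ℝ × ℝ in 𝓝 (a, b, y), g q.2.1 < u :=
      (isOpen_lt (by fun_prop) (by fun_prop)).mem_nhds h2
    filter_upwards [e1, e2] with q hq1 hq2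
    exact (hG.transport_lt hg _ hq1).trans hq2

/-- The homeomorphism of the plane that straightens the graphs of the family. -/
noncomputable def straighten (hG : IsDenseFamily G) : (ℝ × ℝ) ≃ₜ (ℝ × ℝ) where
  toFun p := (p.1, transport G p.1 0 p.2)
  invFun p := (p.1, transport G 0 p.1 p.2)
  left_inv p := by ext <;> simp [hG.transport_transport]
  right_inv p := by ext <;> simp [hG.transport_transport]
  continuous_toFun := continuous_fst.prodMk
    (hG.continuous_transport.comp (by fun_prop : Continuous fun p : ℝ × ℝ => (p.1, (0 : ℝ), p.2)))
  continuous_invFun := continuous_fst.prodMk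
    (hG.continuous_transport.comp (by fun_prop : Continuous fun p : ℝ × ℝ => ((0 : ℝ), p.1, p.2)))

/-- A chart of the whole plane onto the open square that takes each graph of the family onto a
horizontal segment. -/
theorem exists_chart (hG : IsDenseFamily G) : ∃ φ : OpenPartialHomeomorph (ℝ × ℝ) (ℝ × ℝ),
    φ.source = univ ∧ φ.target = Ioo (-1 : ℝ) 1 ×ˢ Ioo (-1 : ℝ) 1 ∧
      ∀ g ∈ G, ∃ T : Set ℝ, φ '' {p | p.2 = g p.1} = Ioo (-1 : ℝ) 1 ×ˢ T := by
  set e : ℝ → ℝ := fun t => orderIsoIooNegOneOne ℝ t with he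
  have heo : IsOpenEmbedding e :=
    isOpen_Ioo.isOpenEmbedding_subtypeVal.comp
      (orderIsoIooNegOneOne ℝ).toHomeomorph.isOpenEmbedding
  have her : range e = Ioo (-1 : ℝ) 1 := by
    have := (orderIsoIooNegOneOne ℝ).surjective.range_comp (Subtype.val : Ioo (-1 : ℝ) 1 → ℝ)
    rw [Subtype.range_coe] at this
    exact this
  have hψ : IsOpenEmbedding (Prod.map e e ∘ hG.straighten) :=
    (heo.prodMap heo).comp hG.straighten.isOpenEmbedding
  refine ⟨hψ.toOpenPartialHomeomorph _, rfl, ?_, fun g hg => ⟨{e (g 0)}, ?_⟩⟩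
  · rw [IsOpenEmbedding.toOpenPartialHomeomorph_target, hG.straighten.surjective.range_comp,
      range_prodMap, her]
  · rw [IsOpenEmbedding.toOpenPartialHomeomorph_apply, ← her]
    ext ⟨u, v⟩
    simp only [mem_image, mem_ofPred_eq, Prod.exists, Function.comp_apply, mem_prod, mem_range,
      mem_singleton_iff, Prod.map_apply', Prod.mk.injEq]
    constructor
    · rintro ⟨x, _, rfl, h1⟩
      have h2 : hG.straighten (x, g x) = (x, g 0) :=
        Prod.ext rfl (hG.transport_apply hg x 0)
      rw [h2] at h1
      exact ⟨⟨x, h1.1⟩, h1.2.symm⟩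
    · rintro ⟨⟨x, rfl⟩, rfl⟩
      refine ⟨x, g x, rfl, ?_⟩
      have h2 : hG.straighten (x, g x) = (x, g 0) :=
        Prod.ext rfl (hG.transport_apply hg x 0)
      rw [h2]
      exact ⟨rfl, rfl⟩

end IsDenseFamily

/-! ### The preimages of the axis as a lamination -/

/-- The functions whose graphs make up `preAxis n`. -/
inductive Leaf : ℕ → (ℝ → ℝ) → Prop
  | axis : Leaf 0 fun _ => 0
  | upper {n : ℕ} {g : ℝ → ℝ} : Leaf n g → Leaf (n + 1) (upperBranch g)
  | lower {n : ℕ} {g : ℝ → ℝ} : Leaf n g → Leaf (n + 1) (lowerBranch g)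

theorem Leaf.contDiff_and_monotone {n : ℕ} {g : ℝ → ℝ} (h : Leaf n g) :
    ContDiff ℝ ∞ g ∧ Monotone g := by
  induction h with
  | axis => exact ⟨contDiff_const, monotone_const⟩
  | upper _ ih =>
    exact ⟨contDiff_upperBranch ih.1 ih.2, monotone_upperBranch ih.1.continuous ih.2⟩
  | lower _ ih =>
    exact ⟨contDiff_lowerBranch ih.1 ih.2, monotone_lowerBranch ih.1.continuous ih.2⟩

theorem Leaf.contDiff {n : ℕ} {g : ℝ → ℝ} (h : Leaf n g) : ContDiff ℝ ∞ g :=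
  h.contDiff_and_monotone.1

theorem Leaf.continuous {n : ℕ} {g : ℝ → ℝ} (h : Leaf n g) : Continuous g :=
  h.contDiff.continuous

theorem Leaf.monotone {n : ℕ} {g : ℝ → ℝ} (h : Leaf n g) : Monotone g :=
  h.contDiff_and_monotone.2

theorem mem_preAxis_iff {n : ℕ} {p : ℝ × ℝ} : p ∈ preAxis n ↔ ∃ g, Leaf n g ∧ p ∈ graph g := by
  induction n generalizing p with
  | zero =>
    constructor
    · exact fun h => ⟨_, .axis, h⟩
    · rintro ⟨_, ⟨⟩, h⟩
      exact h
  | succ n ih =>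
    constructor
    · rintro ⟨h1, h2⟩
      obtain ⟨g, hg, hp⟩ := ih.1 h2
      rcases lt_or_gt_of_ne h1 with h | h
      · exact ⟨_, .lower hg, (mem_graph_lowerBranch hg.continuous hg.monotone).2 ⟨h, hp⟩⟩
      · exact ⟨_, .upper hg, (mem_graph_upperBranch hg.continuous hg.monotone).2 ⟨h, hp⟩⟩
    · rintro ⟨g, hg, hp⟩
      cases hg with
      | upper hg =>
        obtain ⟨h1, h2⟩ := (mem_graph_upperBranch hg.continuous hg.monotone).1 hp
        exact ⟨h1.ne', ih.2 ⟨_, hg, h2⟩⟩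
      | lower hg =>
        obtain ⟨h1, h2⟩ := (mem_graph_lowerBranch hg.continuous hg.monotone).1 hp
        exact ⟨h1.ne, ih.2 ⟨_, hg, h2⟩⟩

/-- A continuous function without zeros on a preconnected set has constant sign. -/
theorem pos_iff_pos_of_isPreconnected {X : Type*} [TopologicalSpace X] {K : Set X}
    (hK : IsPreconnected K) {f : X → ℝ} (hf : ContinuousOn f K) (h0 : ∀ p ∈ K, f p ≠ 0) {p q : X}
    (hp : p ∈ K) (hq : q ∈ K) : 0 < f p ↔ 0 < f q := by
  have key : ∀ p ∈ K, ∀ q ∈ K, 0 < f p → 0 < f q := by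
    intro p hp q hq h
    by_contra! h'
    obtain ⟨r, hr, hr0⟩ := hK.intermediate_value hq hp hf ⟨h', h.le⟩
    exact h0 r hr hr0
  exact ⟨key p hp q hq, key q hq p hp⟩

theorem continuousOn_hd {K : Set (ℝ × ℝ)} (hK : ∀ p ∈ K, p.2 ≠ 0) : ContinuousOn hd K := by
  have h : ContinuousOn (fun p : ℝ × ℝ => 1 / p.2) K :=
    continuousOn_const.div continuousOn_snd hK
  exact (continuousOn_fst.add h).prodMk ((continuousOn_snd.sub h).sub continuousOn_fst)

/-- A connected subset of `preAxis (n + 1)` avoids the axis, so it lies on one side, and `hd` maps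
it to a connected subset of `preAxis n`. -/
theorem Leaf.subset_graph_of_isPreconnected {n : ℕ} {g : ℝ → ℝ} (hg : Leaf n g)
    {K : Set (ℝ × ℝ)} (hK : IsPreconnected K) (hKn : K ⊆ preAxis n) {p : ℝ × ℝ} (hp : p ∈ K)
    (hpg : p ∈ graph g) : K ⊆ graph g := by
  induction hg generalizing K p with
  | axis => exact hKn
  | upper hg ih =>
    have hne : ∀ q ∈ K, q.2 ≠ 0 := fun q hq => (hKn hq).1
    rw [mem_graph_upperBranch hg.continuous hg.monotone] at hpg
    intro q hq
    rw [mem_graph_upperBranch hg.continuous hg.monotone]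
    exact ⟨(pos_iff_pos_of_isPreconnected hK continuousOn_snd hne hp hq).1 hpg.1,
      ih (hK.image _ (continuousOn_hd hne)) (image_subset_iff.2 fun r hr => (hKn hr).2)
        (mem_image_of_mem _ hp) hpg.2 (mem_image_of_mem _ hq)⟩
  | lower hg ih =>
    have hne : ∀ q ∈ K, q.2 ≠ 0 := fun q hq => (hKn hq).1
    rw [mem_graph_lowerBranch hg.continuous hg.monotone] at hpg
    intro q hq
    rw [mem_graph_lowerBranch hg.continuous hg.monotone]
    have hs := pos_iff_pos_of_isPreconnected hK continuousOn_snd hne hp hq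
    exact ⟨lt_of_le_of_ne (not_lt.1 fun h => hpg.1.not_gt (hs.2 h)) (hne q hq),
      ih (hK.image _ (continuousOn_hd hne)) (image_subset_iff.2 fun r hr => (hKn hr).2)
        (mem_image_of_mem _ hp) hpg.2 (mem_image_of_mem _ hq)⟩

theorem range_graph (g : ℝ → ℝ) : range (fun t => (t, g t)) = graph g := by
  ext ⟨x, y⟩
  simp [mem_graph, eq_comm]

theorem isPreconnected_graph {g : ℝ → ℝ} (hg : Continuous g) : IsPreconnected (graph g) := by
  rw [← range_graph]
  exact isPreconnected_range (by fun_prop)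

theorem Leaf.connectedComponentIn_eq {n : ℕ} {g : ℝ → ℝ} (hg : Leaf n g) {p : ℝ × ℝ}
    (hp : p ∈ graph g) : connectedComponentIn (preAxis n) p = graph g := by
  have hsub : graph g ⊆ preAxis n := fun q hq => mem_preAxis_iff.2 ⟨g, hg, hq⟩
  refine Subset.antisymm ?_
    ((isPreconnected_graph hg.continuous).subset_connectedComponentIn hp hsub)
  exact hg.subset_graph_of_isPreconnected isPreconnected_connectedComponentIn
    (connectedComponentIn_subset _ _) (mem_connectedComponentIn (hsub hp)) hp

theorem mem_curvesOf_preAxis {C : Set (ℝ × ℝ)} :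
    C ∈ curvesOf preAxis ↔ ∃ n g, Leaf n g ∧ C = graph g := by
  constructor
  · rintro ⟨n, p, hp, rfl⟩
    obtain ⟨g, hg, hpg⟩ := mem_preAxis_iff.1 hp
    exact ⟨n, g, hg, hg.connectedComponentIn_eq hpg⟩
  · rintro ⟨n, g, hg, rfl⟩
    have hp : ((0 : ℝ), g 0) ∈ graph g := rfl
    exact ⟨n, (0, g 0), mem_preAxis_iff.2 ⟨g, hg, hp⟩, (hg.connectedComponentIn_eq hp).symm⟩

theorem disjoint_preAxis {m n : ℕ} (hmn : m < n) : Disjoint (preAxis m) (preAxis n) := by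
  rw [Set.disjoint_left]
  intro p hm hn
  induction m generalizing n p with
  | zero =>
    obtain ⟨k, rfl⟩ : ∃ k, n = k + 1 := ⟨n - 1, by omega⟩
    exact hn.1 hm
  | succ m ih =>
    obtain ⟨k, rfl⟩ : ∃ k, n = k + 1 := ⟨n - 1, by omega⟩
    exact ih (by omega) hm.2 hn.2

theorem Leaf.eq_of_apply_eq {m n : ℕ} {g h : ℝ → ℝ} (hg : Leaf m g) (hh : Leaf n h) {x : ℝ}
    (e : g x = h x) : g = h := by
  have hp : (x, g x) ∈ graph g := rfl
  have hq : (x, g x) ∈ graph h := e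
  have hp' := mem_preAxis_iff.2 ⟨g, hg, hp⟩
  have hq' := mem_preAxis_iff.2 ⟨h, hh, hq⟩
  rcases lt_trichotomy m n with hmn | rfl | hmn
  · exact absurd hq' (Set.disjoint_left.1 (disjoint_preAxis hmn) hp')
  · have : graph g = graph h := by
      rw [← hg.connectedComponentIn_eq hp, ← hh.connectedComponentIn_eq hq]
    funext t
    have ht : (t, g t) ∈ graph g := rfl
    rw [this] at ht
    exact ht
  · exact absurd hp' (Set.disjoint_left.1 (disjoint_preAxis hmn) hq')

theorem exists_mem_preAxis_of_lt {x y y' : ℝ} (hlt : y < y') :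
    ∃ n, ∃ z ∈ Icc y y', (x, z) ∈ preAxis n := by
  by_contra! h
  set K : Set (ℝ × ℝ) := (fun z => (x, z)) '' Icc y y' with hK
  have hKc : IsPreconnected K := isPreconnected_Icc.image _ (by fun_prop)
  have mem_preAxis : ∀ n p, (∀ j < n, (hd^[j] p).2 ≠ 0) → (hd^[n] p).2 = 0 → p ∈ preAxis n := by
    intro n
    induction n with
    | zero => exact fun p _ h => h
    | succ n ih =>
      intro p h1 h2
      exact ⟨h1 0 (by omega), ih _ (fun j hj => h1 (j + 1) (by omega)) h2⟩
  have hne : ∀ n, ∀ p ∈ K, (hd^[n] p).2 ≠ 0 := by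
    intro n
    induction n using Nat.strong_induction_on with
    | _ n ih =>
      rintro _ ⟨z, hz, rfl⟩ h0
      exact h n z hz (mem_preAxis n _ (fun j hj => ih j hj _ ⟨z, hz, rfl⟩) h0)
  have hcont : ∀ n, ContinuousOn (hd^[n]) K := by
    intro n
    induction n with
    | zero => exact continuousOn_id
    | succ n ih =>
      rw [Function.iterate_succ']
      refine (continuousOn_hd (K := hd^[n] '' K) ?_).comp ih (mapsTo_image _ _)
      rintro _ ⟨p, hp, rfl⟩
      exact hne n p hp
  have hy : (x, y) ∈ K := ⟨y, left_mem_Icc.2 hlt.le, rfl⟩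
  have hy' : (x, y') ∈ K := ⟨y', right_mem_Icc.2 hlt.le, rfl⟩
  have hstep1 : ∀ p : ℝ × ℝ, ∀ n,
      (hd^[n + 1] p).1 = (hd^[n] p).1 + 1 / (hd^[n] p).2 := by
    intro p n
    rw [Function.iterate_succ_apply', hd]
  have hstep2 : ∀ p : ℝ × ℝ, ∀ n,
      (hd^[n + 1] p).2 = (hd^[n] p).2 - (hd^[n + 1] p).1 := by
    intro p n
    rw [Function.iterate_succ_apply', hd]
    ring
  refine not_forall_same_side (x := fun n => (hd^[n] (x, y')).1) (y := fun n => (hd^[n] (x, y')).2)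
    (x' := fun n => (hd^[n] (x, y)).1) (y' := fun n => (hd^[n] (x, y)).2)
    (hstep1 (x, y')) (hstep2 (x, y')) (hstep1 (x, y)) (hstep2 (x, y)) rfl hlt fun n => ?_
  have hs := pos_iff_pos_of_isPreconnected hKc (continuousOn_snd.comp (hcont n) (mapsTo_univ _ _))
    (hne n) hy' hy
  simp only [Function.comp_apply] at hs
  rcases lt_or_gt_of_ne (hne n _ hy') with h1 | h1
  · exact mul_pos_of_neg_of_neg h1
      (lt_of_le_of_ne (not_lt.1 fun h2 => h1.not_gt (hs.2 h2)) (hne n _ hy))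
  · exact mul_pos h1 (hs.1 h1)

theorem isDenseFamily_leaf : IsDenseFamily {g | ∃ n, Leaf n g} where
  continuous := by
    rintro g ⟨n, hg⟩
    exact hg.continuous
  lt_of_lt := by
    rintro g ⟨n, hg⟩ h ⟨m, hh⟩ x x' hlt
    have hc : ContinuousOn (fun t => h t - g t) univ :=
      (hh.continuous.sub hg.continuous).continuousOn
    have h0 : ∀ t ∈ univ, h t - g t ≠ 0 := by
      intro t _ h0
      have := hg.eq_of_apply_eq hh (sub_eq_zero.1 h0).symm
      rw [this] at hlt
      exact lt_irrefl _ hlt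
    exact sub_pos.1 ((pos_iff_pos_of_isPreconnected isPreconnected_univ hc h0
      (mem_univ x) (mem_univ x')).1 (sub_pos.2 hlt))
  dense := by
    intro x y y' hlt
    -- The middle third turns weak bounds into strict ones.
    obtain ⟨n, z, hz, hn⟩ := exists_mem_preAxis_of_lt (x := x)
      (by linarith : (2 * y + y') / 3 < (y + 2 * y') / 3)
    obtain ⟨g, hg, hgz⟩ := mem_preAxis_iff.1 hn
    have : z = g x := hgz
    exact ⟨g, ⟨n, hg⟩, by linarith [hz.1], by linarith [hz.2]⟩

theorem isSmoothLine_graph {g : ℝ → ℝ} (hg : ContDiff ℝ ∞ g) : IsSmoothLine (graph g) := by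
  refine ⟨fun t => (t, g t), contDiff_id.prodMk hg, fun t => ?_, ?_, range_graph g⟩
  · have h : HasDerivAt (fun t => (t, g t)) (1, deriv g t) t :=
      (hasDerivAt_id t).prodMk ((hg.differentiable (by simp) t).hasDerivAt)
    rw [h.deriv]
    simp
  · have hc := hg.continuous
    exact Function.LeftInverse.isClosedEmbedding (f := Prod.fst) (fun t => rfl) continuous_fst
      (by fun_prop)

theorem isLamination_preAxis : IsLamination (curvesOf preAxis) where
  smooth := by
    intro C hC
    obtain ⟨n, g, hg, rfl⟩ := mem_curvesOf_preAxis.1 hC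
    exact isSmoothLine_graph hg.contDiff
  disjoint := by
    intro C hC D hD hne
    obtain ⟨n, g, hg, rfl⟩ := mem_curvesOf_preAxis.1 hC
    obtain ⟨m, h, hh, rfl⟩ := mem_curvesOf_preAxis.1 hD
    refine Set.disjoint_left.2 fun p hp hq => hne ?_
    rw [hg.eq_of_apply_eq hh ((mem_graph.1 hp).symm.trans (mem_graph.1 hq))]
  flowBox := by
    intro p
    obtain ⟨φ, h1, h2, h3⟩ := isDenseFamily_leaf.exists_chart
    refine ⟨φ, by rw [h1]; trivial, h2, fun C hC => ?_⟩
    obtain ⟨n, g, hg, rfl⟩ := mem_curvesOf_preAxis.1 hC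
    obtain ⟨T, hT⟩ := h3 g ⟨n, hg⟩
    exact ⟨T, by rw [h1, inter_univ]; exact hT⟩

/-! ### Time reversal and the images of the antidiagonal -/

/-- The linear involution that conjugates `hd` to `hdInv`. -/
def flip : (ℝ × ℝ) ≃ₜ (ℝ × ℝ) where
  toFun p := (p.1, -p.1 - p.2)
  invFun p := (p.1, -p.1 - p.2)
  left_inv p := by ext <;> simp
  right_inv p := by ext <;> simp
  continuous_toFun := by fun_prop
  continuous_invFun := by fun_prop

theorem flip_apply (p : ℝ × ℝ) : flip p = (p.1, -p.1 - p.2) := rfl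

theorem flip_flip (p : ℝ × ℝ) : flip (flip p) = p := flip.symm_apply_apply p

theorem image_flip (S : Set (ℝ × ℝ)) : flip '' S = flip ⁻¹' S :=
  flip.image_eq_preimage_symm S

theorem hd_flip (p : ℝ × ℝ) : hd (flip p) = flip (hdInv p) := by
  have e : -p.1 - p.2 = -(p.1 + p.2) := by ring
  simp only [flip_apply, hd, hdInv, e, one_div, inv_neg]
  ext
  · rfl
  · simp only
    ring

theorem mem_imgAnti_iff {n : ℕ} {p : ℝ × ℝ} : p ∈ imgAnti n ↔ flip p ∈ preAxis n := by
  induction n generalizing p with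
  | zero =>
    simp only [imgAnti, preAxis, mem_ofPred_eq, flip_apply]
    constructor <;> intro h <;> linarith
  | succ n ih =>
    have hsnd : (flip p).2 = -(p.1 + p.2) := by
      simp only [flip_apply]
      ring
    constructor
    · rintro ⟨q, ⟨hq, hq0⟩, rfl⟩
      obtain ⟨h1, h2⟩ := hdInv_hd q hq0
      refine ⟨by rw [hsnd]; exact neg_ne_zero.2 h1, ?_⟩
      rw [hd_flip, h2]
      exact ih.1 hq
    · rintro ⟨h1, h2⟩
      rw [hsnd, neg_ne_zero] at h1
      obtain ⟨h3, h4⟩ := hd_hdInv p h1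
      rw [hd_flip] at h2
      exact ⟨hdInv p, ⟨ih.2 h2, h3⟩, h4⟩

theorem imgAnti_eq (n : ℕ) : imgAnti n = flip '' preAxis n := by
  ext p
  rw [mem_imgAnti_iff, image_flip, mem_preimage]

theorem mem_curvesOf_imgAnti {C : Set (ℝ × ℝ)} :
    C ∈ curvesOf imgAnti ↔ ∃ D ∈ curvesOf preAxis, C = flip '' D := by
  constructor
  · rintro ⟨n, p, hp, rfl⟩
    rw [mem_imgAnti_iff] at hp
    refine ⟨_, ⟨n, flip p, hp, rfl⟩, ?_⟩
    rw [flip.image_connectedComponentIn hp, flip_flip, imgAnti_eq]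
  · rintro ⟨_, ⟨n, p, hp, rfl⟩, rfl⟩
    refine ⟨n, flip p, by rwa [mem_imgAnti_iff, flip_flip], ?_⟩
    rw [flip.image_connectedComponentIn hp, imgAnti_eq]

theorem isLamination_imgAnti : IsLamination (curvesOf imgAnti) where
  smooth := by
    intro C hC
    obtain ⟨D, hD, rfl⟩ := mem_curvesOf_imgAnti.1 hC
    obtain ⟨γ, h1, h2, h3, rfl⟩ := isLamination_preAxis.smooth D hD
    refine ⟨flip ∘ γ, h1.fst.prodMk (h1.fst.neg.sub h1.snd), fun t ht => h2 t ?_,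
      flip.isClosedEmbedding.comp h3, range_comp _ _⟩
    have hd0 : HasDerivAt γ (deriv γ t) t := (h1.differentiable (by simp) t).hasDerivAt
    have hd1 : HasDerivAt (fun s => (γ s).1) (deriv γ t).1 t := hd0.fst
    have hd2 : HasDerivAt (fun s => (γ s).2) (deriv γ t).2 t := hd0.snd
    have hd3 : HasDerivAt (flip ∘ γ) ((deriv γ t).1, -(deriv γ t).1 - (deriv γ t).2) t :=
      hd1.prodMk (hd1.neg.sub hd2)
    rw [hd3.deriv, Prod.mk_eq_zero] at ht
    exact Prod.ext ht.1 (by simp only [Prod.snd_zero]; linarith [ht.1, ht.2])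
  disjoint := by
    intro C hC D hD hne
    obtain ⟨C, hC', rfl⟩ := mem_curvesOf_imgAnti.1 hC
    obtain ⟨D, hD', rfl⟩ := mem_curvesOf_imgAnti.1 hD
    exact (disjoint_image_iff flip.injective).2
      (isLamination_preAxis.disjoint hC' hD' fun h => hne (by rw [h]))
  flowBox := by
    intro p
    obtain ⟨φ, h1, h2, h3⟩ := isLamination_preAxis.flowBox (flip p)
    refine ⟨flip.toOpenPartialHomeomorph.trans φ, by simpa using h1, by simpa using h2,
      fun C hC => ?_⟩
    obtain ⟨D, hD, rfl⟩ := mem_curvesOf_imgAnti.1 hC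
    obtain ⟨T, hT⟩ := h3 D hD
    refine ⟨T, ?_⟩
    rw [← hT]
    ext q
    simp only [OpenPartialHomeomorph.coe_trans, Homeomorph.toOpenPartialHomeomorph_apply,
      OpenPartialHomeomorph.trans_source, Homeomorph.toOpenPartialHomeomorph_source, univ_inter,
      mem_image, mem_inter_iff, mem_preimage, Function.comp_apply]
    constructor
    · rintro ⟨_, ⟨⟨r, hr, rfl⟩, hs⟩, rfl⟩
      exact ⟨flip (flip r), ⟨by rwa [flip_flip], hs⟩, rfl⟩
    · rintro ⟨r, ⟨hr, hs⟩, rfl⟩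
      exact ⟨flip r, ⟨⟨r, hr, rfl⟩, by rwa [flip_flip]⟩, by rw [flip_flip]⟩

/-! ### Transversality -/

theorem mem_tangentVectors_graph {g : ℝ → ℝ} (hg : Differentiable ℝ g) {p : ℝ × ℝ}
    (hp : p ∈ graph g) : (1, deriv g p.1) ∈ tangentVectors (graph g) p := by
  refine ⟨fun t => (p.1 + t, g (p.1 + t)), fun t => rfl, ?_, ?_⟩
  · simp only [add_zero]
    exact Prod.ext rfl hp.symm
  · have h1 : HasDerivAt (fun t => p.1 + t) 1 0 := (hasDerivAt_id (0 : ℝ)).const_add p.1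
    have h2 : HasDerivAt g (deriv g p.1) (p.1 + 0) := by
      rw [add_zero]
      exact (hg _).hasDerivAt
    simpa using h1.prodMk (h2.comp 0 h1)

theorem flip_mem_tangentVectors {C : Set (ℝ × ℝ)} {p v : ℝ × ℝ} (h : v ∈ tangentVectors C p) :
    flip v ∈ tangentVectors (flip '' C) (flip p) := by
  obtain ⟨γ, h1, rfl, h3⟩ := h
  have hd1 : HasDerivAt (fun s => (γ s).1) v.1 0 := h3.fst
  have hd2 : HasDerivAt (fun s => (γ s).2) v.2 0 := h3.snd
  exact ⟨flip ∘ γ, fun t => mem_image_of_mem _ (h1 t), rfl, hd1.prodMk (hd1.neg.sub hd2)⟩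

theorem span_eq_top_of_det_ne_zero {u v : ℝ × ℝ} (h : u.1 * v.2 - u.2 * v.1 ≠ 0)
    {S : Set (ℝ × ℝ)} (hu : u ∈ S) (hv : v ∈ S) : Submodule.span ℝ S = ⊤ := by
  rw [eq_top_iff]
  rintro w -
  have e : w = ((w.1 * v.2 - w.2 * v.1) / (u.1 * v.2 - u.2 * v.1)) • u +
      ((u.1 * w.2 - u.2 * w.1) / (u.1 * v.2 - u.2 * v.1)) • v := by
    ext <;> simp only [Prod.fst_add, Prod.snd_add, Prod.smul_fst, Prod.smul_snd, smul_eq_mul] <;>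
      rw [div_mul_eq_mul_div, div_mul_eq_mul_div, ← add_div, eq_div_iff h] <;> ring
  rw [e]
  exact Submodule.add_mem _ (Submodule.smul_mem _ _ (Submodule.subset_span hu))
    (Submodule.smul_mem _ _ (Submodule.subset_span hv))

theorem transverse_curves {C D : Set (ℝ × ℝ)} (hC : C ∈ curvesOf preAxis)
    (hD : D ∈ curvesOf imgAnti) : Transverse C D := by
  obtain ⟨n, g, hg, rfl⟩ := mem_curvesOf_preAxis.1 hC
  obtain ⟨E, hE, rfl⟩ := mem_curvesOf_imgAnti.1 hD
  obtain ⟨m, h, hh, rfl⟩ := mem_curvesOf_preAxis.1 hE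
  rintro p ⟨hp, q, hq, rfl⟩
  have hg' := mem_tangentVectors_graph (hg.contDiff.differentiable (by simp)) hp
  have hh' := flip_mem_tangentVectors
    (mem_tangentVectors_graph (hh.contDiff.differentiable (by simp)) hq)
  -- The tangent vectors are `(1, a)` and `(1, -1 - b)` with `a, b ≥ 0`, of determinant `-1 - b - a
  -- < 0`.
  refine span_eq_top_of_det_ne_zero (ne_of_lt ?_) (Or.inl hg') (Or.inr hh')
  have h1 : 0 ≤ deriv g (flip q).1 := hg.monotone.deriv_nonneg
  have h2 : 0 ≤ deriv h q.1 := hh.monotone.deriv_nonneg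
  simp only [flip_apply] at h1 ⊢
  linarith

/-! ### Monotonicity in the parameter -/

theorem continuousOn_hdInv {K : Set (ℝ × ℝ)} (hK : ∀ p ∈ K, p.1 + p.2 ≠ 0) :
    ContinuousOn hdInv K := by
  have h : ContinuousOn (fun p : ℝ × ℝ => 1 / (p.1 + p.2)) K :=
    continuousOn_const.div (continuousOn_fst.add continuousOn_snd) hK
  exact (continuousOn_fst.sub h).prodMk (continuousOn_fst.add continuousOn_snd)

theorem continuousOn_iterate_hdInv {K : Set ℝ} (n : ℕ) (hK : K ⊆ preDomain n) :
    ContinuousOn (fun t : ℝ => hdInv^[n] (t, 0)) K := by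
  induction n with
  | zero => exact (by fun_prop : Continuous fun t : ℝ => (t, (0 : ℝ))).continuousOn
  | succ n ih =>
    have h := ih fun t ht j hj => hK ht j (by omega)
    simp only [Function.iterate_succ_apply']
    refine (continuousOn_hdInv (K := (fun t : ℝ => hdInv^[n] (t, 0)) '' K) ?_).comp h
      (mapsTo_image _ _)
    rintro _ ⟨t, ht, rfl⟩
    exact hK ht n (by omega)

/-- The sum of the coordinates increases with the parameter and has constant sign on `K`, so its
reciprocal decreases. The second coordinate is constant for `n = 0`; the induction therefore carries
only its weak inequality. -/
theorem iterate_hdInv_lt {K : Set ℝ} (hKc : IsPreconnected K) (n : ℕ) (hK : K ⊆ preDomain n)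
    {s t : ℝ} (hs : s ∈ K) (ht : t ∈ K) (hst : s < t) :
    (hdInv^[n] (s, 0)).1 < (hdInv^[n] (t, 0)).1 ∧
      (hdInv^[n] (s, 0)).2 ≤ (hdInv^[n] (t, 0)).2 ∧
      (1 ≤ n → (hdInv^[n] (s, 0)).2 < (hdInv^[n] (t, 0)).2) := by
  induction n with
  | zero => exact ⟨hst, le_rfl, fun h => by omega⟩
  | succ n ih =>
    have hKn : K ⊆ preDomain n := fun t ht j hj => hK ht j (by omega)
    obtain ⟨h1, h2, -⟩ := ih hKn
    have hc := continuousOn_iterate_hdInv n hKn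
    have hsign := pos_iff_pos_of_isPreconnected hKc (hc.fst.add hc.snd)
      (fun t ht => hK ht n (by omega)) hs ht
    have hs0 := hK hs n (by omega)
    have ht0 := hK ht n (by omega)
    simp only [Function.iterate_succ_apply', hdInv]
    set a := (hdInv^[n] (s, 0)).1 + (hdInv^[n] (s, 0)).2 with ha
    set b := (hdInv^[n] (t, 0)).1 + (hdInv^[n] (t, 0)).2 with hb
    have hab : a < b := by linarith
    have hinv : 1 / b < 1 / a := by
      rcases lt_or_gt_of_ne ht0 with h | h
      · exact one_div_lt_one_div_of_neg_of_lt h hab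
      · exact one_div_lt_one_div_of_lt (hsign.2 h) hab
    exact ⟨by linarith, hab.le, fun _ => hab⟩

theorem iterate_hd_anti (n : ℕ) (t : ℝ) : hd^[n] (t, -t) = flip (hdInv^[n] (t, 0)) := by
  have h : Function.Semiconj flip hdInv hd := fun p => (hd_flip p).symm
  rw [(h.iterate_right n).eq, flip_apply]
  simp

theorem imgDomain_eq (n : ℕ) : imgDomain n = preDomain n := by
  ext t
  simp only [imgDomain, preDomain, mem_ofPred_eq, iterate_hd_anti, flip_apply]
  refine forall₂_congr fun j _ => ?_
  rw [← neg_add', neg_ne_zero]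

/-! ### The highest curves -/

/-- The function whose graph is the highest curve of order `n`. -/
noncomputable def topLeaf (n : ℕ) : ℝ → ℝ := upperBranch^[n] fun _ => 0

theorem topLeaf_succ (n : ℕ) : topLeaf (n + 1) = upperBranch (topLeaf n) :=
  Function.iterate_succ_apply' _ _ _

theorem leaf_topLeaf (n : ℕ) : Leaf n (topLeaf n) := by
  induction n with
  | zero => exact .axis
  | succ n ih =>
    rw [topLeaf_succ]
    exact .upper ih

theorem topLeaf_le_succ (n : ℕ) (x : ℝ) : topLeaf n x ≤ topLeaf (n + 1) x := by
  induction n generalizing x with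
  | zero => exact (upperBranch_spec continuous_const monotone_const x).1.le
  | succ n ih =>
    rw [topLeaf_succ n, topLeaf_succ (n + 1)]
    have h := leaf_topLeaf n
    have h' := leaf_topLeaf (n + 1)
    exact upperBranch_mono h.continuous h.monotone h'.continuous h'.monotone ih x

theorem Leaf.le_topLeaf {n : ℕ} {g : ℝ → ℝ} (hg : Leaf n g) (x : ℝ) : g x ≤ topLeaf n x := by
  induction hg generalizing x with
  | axis => exact le_rfl
  | @upper n g hg ih =>
    rw [topLeaf_succ]
    have h := leaf_topLeaf n
    exact upperBranch_mono hg.continuous hg.monotone h.continuous h.monotone ih x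
  | @lower n g hg ih =>
    rw [topLeaf_succ]
    have h := leaf_topLeaf n
    have h1 := (upperBranch_spec h.continuous h.monotone x).1
    have h2 : ((x, lowerBranch g x) : ℝ × ℝ) ∈ graph (lowerBranch g) := rfl
    have h3 := ((mem_graph_lowerBranch hg.continuous hg.monotone).1 h2).1
    exact h3.le.trans h1.le

/-- By density some leaf passes above any given height, and the highest leaf of its order lies no
lower. -/
theorem tendsto_topLeaf (x : ℝ) : Tendsto (fun n => topLeaf n x) atTop atTop := by
  refine tendsto_atTop_atTop_of_monotone (monotone_nat_of_le_succ fun n => topLeaf_le_succ n x)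
    fun b => ?_
  obtain ⟨g, ⟨n, hg⟩, h1, -⟩ := isDenseFamily_leaf.dense x b (b + 1) (by linarith)
  exact ⟨n, h1.le.trans (hg.le_topLeaf x)⟩

/-- The sum of the coordinates is the height after one application of `hdInv`, so its positivity at
each step means that the upper branch is always taken. -/
theorem mem_graph_topLeaf {n : ℕ} {p : ℝ × ℝ} : p ∈ graph (topLeaf n) ↔
    ∃ t, (∀ j < n, 0 < (hdInv^[j] (t, 0)).1 + (hdInv^[j] (t, 0)).2) ∧ hdInv^[n] (t, 0) = p := by
  induction n generalizing p with
  | zero =>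
    constructor
    · exact fun h => ⟨p.1, by simp, Prod.ext rfl h.symm⟩
    · rintro ⟨t, -, rfl⟩
      rfl
  | succ n ih =>
    have hl := leaf_topLeaf n
    rw [topLeaf_succ, mem_graph_upperBranch hl.continuous hl.monotone, ih]
    constructor
    · rintro ⟨hp, t, ht, e⟩
      obtain ⟨-, h2⟩ := hdInv_hd p hp.ne'
      refine ⟨t, fun j hj => ?_, by rw [Function.iterate_succ_apply', e, h2]⟩
      rcases Nat.lt_succ_iff_lt_or_eq.1 hj with hj | rfl
      · exact ht j hj
      · rw [e]
        have : (hd p).1 + (hd p).2 = p.2 := by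
          simp only [hd]
          ring
        rwa [this]
    · rintro ⟨t, ht, rfl⟩
      have hpos := ht n (by omega)
      rw [Function.iterate_succ_apply']
      exact ⟨hpos, t, fun j hj => ht j (by omega), (hd_hdInv _ hpos.ne').2.symm⟩

theorem iterate_hd_iterate_hdInv {n : ℕ} {t : ℝ} (ht : t ∈ preDomain n) :
    hd^[n] (hdInv^[n] (t, 0)) = (t, 0) := by
  induction n with
  | zero => rfl
  | succ n ih =>
    rw [Function.iterate_succ_apply' hdInv, Function.iterate_succ_apply hd,
      (hd_hdInv _ (ht n (by omega))).2]
    exact ih fun j hj => ht j (by omega)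

/-- The parameter at which the highest curve of order `n` meets the `y`-axis. -/
noncomputable def axisParameter (n : ℕ) : ℝ := (hd^[n] (0, topLeaf n 0)).1

theorem axisParameter_spec (n : ℕ) :
    (∀ j < n, 0 < (hdInv^[j] (axisParameter n, 0)).1 + (hdInv^[j] (axisParameter n, 0)).2) ∧
      hdInv^[n] (axisParameter n, 0) = (0, topLeaf n 0) := by
  obtain ⟨t, h1, h2⟩ :=
    mem_graph_topLeaf.1 (rfl : ((0 : ℝ), topLeaf n 0) ∈ graph (topLeaf n))
  have e : axisParameter n = t := by
    rw [axisParameter, ← h2, iterate_hd_iterate_hdInv fun j hj => (h1 j hj).ne']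
  rw [e]
  exact ⟨h1, h2⟩

theorem eq_axisParameter_iff (n : ℕ) (t : ℝ) :
    ((∀ j < n, 0 < (hdInv^[j] (t, 0)).1 + (hdInv^[j] (t, 0)).2) ∧ (hdInv^[n] (t, 0)).1 = 0) ↔
      t = axisParameter n := by
  constructor
  · rintro ⟨h1, h2⟩
    have h3 : (hdInv^[n] (t, 0)).2 = topLeaf n (hdInv^[n] (t, 0)).1 :=
      mem_graph_topLeaf.2 ⟨t, h1, rfl⟩
    rw [h2] at h3
    have h4 : hdInv^[n] (t, 0) = (0, topLeaf n 0) := Prod.ext h2 h3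
    rw [axisParameter, ← h4, iterate_hd_iterate_hdInv fun j hj => (h1 j hj).ne']
  · rintro rfl
    obtain ⟨h1, h2⟩ := axisParameter_spec n
    exact ⟨h1, by rw [h2]⟩

theorem disjoint_preAxis_of_ne {m n : ℕ} (h : m ≠ n) : Disjoint (preAxis m) (preAxis n) := by
  rcases lt_or_gt_of_ne h with h | h
  · exact disjoint_preAxis h
  · exact (disjoint_preAxis h).symm

end HenonDevaney

theorem lemma1 :
    -- the two laminations and their transversality
    HenonDevaney.IsLamination (HenonDevaney.curvesOf HenonDevaney.preAxis) ∧
    HenonDevaney.IsLamination (HenonDevaney.curvesOf HenonDevaney.imgAnti) ∧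
    (∀ C ∈ HenonDevaney.curvesOf HenonDevaney.preAxis,
      ∀ D ∈ HenonDevaney.curvesOf HenonDevaney.imgAnti, HenonDevaney.Transverse C D) ∧
    -- pre-images of different orders are disjoint, and so are images of different orders
    (∀ m n : ℕ, m ≠ n → Disjoint (HenonDevaney.preAxis m) (HenonDevaney.preAxis n)) ∧
    (∀ m n : ℕ, m ≠ n → Disjoint (HenonDevaney.imgAnti m) (HenonDevaney.imgAnti n)) ∧
    -- monotonicity of the coordinates in the parameter
    (∀ n : ℕ, 1 ≤ n → ∀ K ⊆ HenonDevaney.preDomain n, IsPreconnected K →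
      StrictMonoOn (fun t : ℝ => (HenonDevaney.hdInv^[n] (t, 0)).1) K ∧
      StrictMonoOn (fun t : ℝ => (HenonDevaney.hdInv^[n] (t, 0)).2) K) ∧
    (∀ n : ℕ, ∀ K ⊆ HenonDevaney.imgDomain n, IsPreconnected K →
      StrictMonoOn (fun t : ℝ => (HenonDevaney.hd^[n] (t, -t)).1) K ∧
      StrictAntiOn (fun t : ℝ => (HenonDevaney.hd^[n] (t, -t)).2) K) ∧
    -- the highest curve of order `n` meets the `y`-axis exactly once, and these points diverge
    (∃ τ : ℕ → ℝ,
      (∀ (n : ℕ) (t : ℝ),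
        ((∀ j < n, 0 < (HenonDevaney.hdInv^[j] (t, 0)).1 + (HenonDevaney.hdInv^[j] (t, 0)).2) ∧
          (HenonDevaney.hdInv^[n] (t, 0)).1 = 0) ↔ t = τ n) ∧
      Tendsto (fun n => (HenonDevaney.hdInv^[n] (τ n, 0)).2) atTop atTop) := by
  refine ⟨HenonDevaney.isLamination_preAxis, HenonDevaney.isLamination_imgAnti,
    fun C hC D hD => HenonDevaney.transverse_curves hC hD,
    fun m n h => HenonDevaney.disjoint_preAxis_of_ne h, fun m n h => ?_,
    fun n hn K hK hKc => ?_, fun n K hK hKc => ?_, HenonDevaney.axisParameter,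
    HenonDevaney.eq_axisParameter_iff, ?_⟩
  · rw [HenonDevaney.imgAnti_eq, HenonDevaney.imgAnti_eq]
    exact (disjoint_image_iff HenonDevaney.flip.injective).2
      (HenonDevaney.disjoint_preAxis_of_ne h)
  · exact ⟨fun s hs t ht hst => (HenonDevaney.iterate_hdInv_lt hKc n hK hs ht hst).1,
      fun s hs t ht hst => (HenonDevaney.iterate_hdInv_lt hKc n hK hs ht hst).2.2 hn⟩
  · rw [HenonDevaney.imgDomain_eq] at hK
    simp only [HenonDevaney.iterate_hd_anti, HenonDevaney.flip_apply]
    refine ⟨fun s hs t ht hst => (HenonDevaney.iterate_hdInv_lt hKc n hK hs ht hst).1,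
      fun s hs t ht hst => ?_⟩
    obtain ⟨h1, h2, -⟩ := HenonDevaney.iterate_hdInv_lt hKc n hK hs ht hst
    simp only
    linarith
  · simp only [fun n => (HenonDevaney.axisParameter_spec n).2]
    exact HenonDevaney.tendsto_topLeaf 0
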